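/- Let $(X_t)_{t\in\mathbb Z}$ be independent identically distributed real random variables with continuous distribution function. Call $n\in\mathbb Z$ a maximum point if $X_n>X_{n-1}$ and $X_n>X_{n+1}$, and a minimum point if $X_n<X_{n-1}$ and $X_n<X_{n+1}$. Condition on the event that $0$ is a maximum point, and let $\mathbf P$, $\mathbf E$, $\mathrm{Var}$, $\mathrm{corr}$ below refer to this conditional probability. Let $\mu_0$ be the distance from $0$ to the next minimum point to its right, $\mu_1$ the distance from that point to the next maximum point to its right, and so on, alternately. For integers $i_1,\dots,i_m\ge 0$ put $s_r=i_1+\dots+i_r$ ($s_0=0$). Let $\Omega(i_1,\dots,i_m)$ be the number of permutations $\tau$ of $\{0,1,\dots,s_m\}$ such that, for each $r=1,\dots,m$ and each $j$ with $s_{r-1}\le j<s_r$, one has $\tau(j)<\tau(j+1)$ if $r$ is odd and $\tau(j)>\tau(j+1)$ if $r$ is even. Put $\Omega'(i_1,\dots,i_m)=\Omega(i_1,\dots,i_m)/(s_m+1)!$. Then almost surely all the distances $\mu_t$ ($t\ge 0$) are well defined, and for all integers $n\ge 0$ and $k_0,\dots,k_n\ge 1$, $$\mathbf P\{\mu_0=k_0,\dots,\mu_n=k_n\}=3\,\Omega'(1,k_0,\dots,k_n,1).$$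 In particular, for every integer $k\ge 1$, $$\mathbf P\{\mu_0=k\}=\frac{3(k^2+3k+1)}{(k+3)!}.$$ Moreover, $\mu_0$ and $\mu_1$ have finite second moments, and $$\mathbf E\mu_0=\frac32,\qquad \mathrm{Var}\,\mu_0=6e-\frac{63}4,\qquad \mathrm{corr}(\mu_0,\mu_1)=\frac{2e^2-8e+7}{8e-21}.$$ -/

import Mathlib

open MeasureTheory ProbabilityTheory

noncomputable section

namespace MonotoneRuns

/-- The permutation `τ` of `{0, …, N}`, where `N` is the sum of `l = (l₀, l₁, l₂, …)`, has the
monotonicity intervals prescribed by `l`: with the partial sums `s m = l₀ + ⋯ + l_{m-1}`, it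
increases on `{s m, …, s (m+1)}` for even `m` and decreases on `{s m, …, s (m+1)}` for odd `m`.
A trailing zero in `l` imposes nothing, so lists of odd length need no separate treatment. -/
def HasRuns (l : List ℕ) (τ : Equiv.Perm (Fin (l.sum + 1))) : Prop :=
  ∀ m < l.length, ∀ j : Fin l.sum,
    (l.take m).sum ≤ (j : ℕ) → (j : ℕ) < (l.take (m + 1)).sum →
      if Even m then τ j.castSucc < τ j.succ else τ j.succ < τ j.castSucc

instance (l : List ℕ) : DecidablePred (HasRuns l) := fun τ => by
  unfold HasRuns; infer_instance

/-- `Ω(l₀, l₁, …)`: the number of permutations with the monotonicity intervals given by `l`. -/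
def Omega (l : List ℕ) : ℕ :=
  (Finset.univ.filter fun τ : Equiv.Perm (Fin (l.sum + 1)) => HasRuns l τ).card

/-- `Ω'(l₀, l₁, …) = Ω(l₀, l₁, …) / (l₀ + l₁ + ⋯ + 1)!`. -/
def Omega' (l : List ℕ) : ℝ :=
  (Omega l : ℝ) / (Nat.factorial (l.sum + 1) : ℝ)

/-- `n` is a maximum point of the two-sided sequence `x`. -/
def IsMaxPoint (x : ℤ → ℝ) (n : ℤ) : Prop :=
  x (n - 1) < x n ∧ x (n + 1) < x n

/-- `n` is a minimum point of the two-sided sequence `x`. -/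
def IsMinPoint (x : ℤ → ℝ) (n : ℤ) : Prop :=
  x n < x (n - 1) ∧ x n < x (n + 1)

/-- The distance from `p` to the next minimum point of `x` to the right of `p` (for even `t`),
or to the next maximum point to the right of `p` (for odd `t`). It is positive if such a point
exists, and `0` if there is none. -/
def nextDist (x : ℤ → ℝ) (t : ℕ) (p : ℤ) : ℕ :=
  sInf {d : ℕ | 0 < d ∧ if Even t then IsMinPoint x (p + d) else IsMaxPoint x (p + d)}

/-- The point reached from `0` after `t` moves, alternately to the next minimum point and to the
next maximum point. -/
def extPoint (x : ℤ → ℝ) : ℕ → ℤ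
  | 0 => 0
  | t + 1 => extPoint x t + nextDist x t (extPoint x t)

/-- `μ_t`: the `t`-th of the successive distances between alternating extremum points,
starting at the maximum point `0`. -/
def mu (x : ℤ → ℝ) (t : ℕ) : ℕ :=
  nextDist x t (extPoint x t)

/-- The correlation coefficient of two real random variables. -/
def corr {Ω : Type*} [MeasurableSpace Ω] (Y Z : Ω → ℝ) (P : Measure Ω) : ℝ :=
  covariance Y Z P / (Real.sqrt (variance Y P) * Real.sqrt (variance Z P))

end MonotoneRuns

end

/-! Almost surely all values are distinct, so every step of the sequence goes up or down. The event
"0 is a maximum point and μ_0 = k_0, …, μ_n = k_n" is then a pattern of steps starting at -1: one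
step up into 0, then alternating runs of lengths k_0, …, k_n, then one step that turns the last
endpoint into an extremum (`isMaxPoint_and_mu_eq_iff`). The ranks of finitely many of the variables
form a uniform random permutation, so this pattern has probability Ω' (`prob_run`). Conditioning
divides by P(0 is a maximum point) = 1/3.

The moments avoid counting permutations. Let V(k,l) be the probability of k descents followed by l
ascents. If the step between a block of descents and a block of ascents is left free, the blocks are
independent, and that step extends one block or the other. This gives a recursion whose solution is
V(k,l) = 1/((k+l+1) k! l!) (`prob_valley`). Requiring a maximum at both ends of the valley takes a
difference of V in each variable (`prob_peak_valley_peak`), so summation telescopes to P(μ_0 > i,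
μ_1 > j) = 3 V(i+1, j+1) under the conditional law. The moments are sums of these tails. They reduce
to the exponential series at 1 and, for the mixed moment, also at 2, because V(k,l) is a binomial
coefficient divided by (k+l+1)!. -/

namespace MonotoneRuns

/-! ### Distances between extremum points as patterns of runs -/

/-- The step of `x` from `j` to `j + 1` goes up (even `c`) or down (odd `c`). -/
def Step (x : ℤ → ℝ) (c : ℕ) (j : ℤ) : Prop :=
  if Even c then x j < x (j + 1) else x (j + 1) < x j

/-- From `p` on, `x` has successive monotone runs of the lengths given by the list, the first one
going up (even `c`) or down (odd `c`), then alternately. -/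
def Run (x : ℤ → ℝ) : ℕ → List ℕ → ℤ → Prop
  | _, [], _ => True
  | c, k :: l, p => (∀ j : ℕ, j < k → Step x c (p + j)) ∧ Run x (c + 1) l (p + k)

/-- The successive distances between extremum points, counted from `p` and from index `t` on,
are those of the list. -/
def Chain (x : ℤ → ℝ) : ℕ → ℤ → List ℕ → Prop
  | _, _, [] => True
  | t, p, k :: l => nextDist x t p = k ∧ Chain x (t + 1) (p + k) l

theorem step_add_two (x : ℤ → ℝ) (c : ℕ) (j : ℤ) : Step x (c + 2) j ↔ Step x c j := by
  simp [Step, Nat.even_add]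

theorem not_step_succ {x : ℤ → ℝ} {c : ℕ} {j : ℤ} (h : Step x c j) : ¬ Step x (c + 1) j := by
  by_cases hc : Even c <;> simp only [Step, Nat.even_add_one, hc, if_true, if_false, not_true,
    not_false_iff] at h ⊢ <;> exact h.not_gt

theorem step_or_step_succ {x : ℤ → ℝ} {j : ℤ} (hx : x j ≠ x (j + 1)) (c : ℕ) :
    Step x c j ∨ Step x (c + 1) j := by
  by_cases hc : Even c <;> simp only [Step, Nat.even_add_one, hc, if_true, if_false, not_true,
    not_false_iff]
  · exact lt_or_gt_of_ne hx
  · exact (lt_or_gt_of_ne hx).symm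

theorem run_iff (x : ℤ → ℝ) (l : List ℕ) : ∀ (c : ℕ) (p : ℤ), Run x c l p ↔
    ∀ m < l.length, ∀ j : ℕ, (l.take m).sum ≤ j → j < (l.take (m + 1)).sum →
      Step x (c + m) (p + j) := by
  induction l with
  | nil => intro c p; simp [Run]
  | cons k l ih =>
    intro c p
    rw [Run, ih]
    constructor
    · rintro ⟨h0, h1⟩ m hm j hj1 hj2
      cases m with
      | zero => exact h0 j (by simpa using hj2)
      | succ m =>
        simp only [List.take_succ_cons, List.sum_cons] at hj1 hj2
        have := h1 m (by simpa using hm) (j - k) (by omega) (by omega)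
        have e : p + (k : ℤ) + ((j - k : ℕ) : ℤ) = p + j := by omega
        rw [e] at this
        rwa [show c + (m + 1) = c + 1 + m by ring]
    · intro h
      refine ⟨fun j hj => ?_, fun m hm j hj1 hj2 => ?_⟩
      · simpa using h 0 (by simp) j (by simp) (by simpa using hj)
      · have := h (m + 1) (by simpa using hm) (k + j)
          (by simpa using hj1) (by simpa using hj2)
        rw [show c + 1 + m = c + (m + 1) by ring]
        push_cast at this
        rwa [← add_assoc p] at this

theorem sum_take_le (l : List ℕ) (m : ℕ) : (l.take m).sum ≤ l.sum :=
  (List.take_sublist m l).sum_le_sum (by simp)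

theorem run_iff_hasRuns {x : ℤ → ℝ} {p : ℤ} {l : List ℕ} {τ : Equiv.Perm (Fin (l.sum + 1))}
    (h : ∀ i j : Fin (l.sum + 1), x (p + (i : ℕ)) < x (p + (j : ℕ)) ↔ τ i < τ j) :
    Run x 0 l p ↔ HasRuns l τ := by
  rw [run_iff]
  unfold HasRuns Step
  refine forall_congr' fun m => forall_congr' fun hm => ?_
  have key : ∀ j : Fin l.sum,
      ((if Even (0 + m) then x (p + (j : ℕ)) < x (p + (j : ℕ) + 1)
        else x (p + (j : ℕ) + 1) < x (p + (j : ℕ))) ↔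
      if Even m then τ j.castSucc < τ j.succ else τ j.succ < τ j.castSucc) := by
    intro j
    have h1 := h j.castSucc j.succ
    have h2 := h j.succ j.castSucc
    simp only [Fin.val_castSucc, Fin.val_succ, Nat.cast_add, Nat.cast_one, ← add_assoc] at h1 h2
    rw [zero_add, h1, h2]
  constructor
  · intro H j h1 h2
    exact (key j).1 (H j h1 h2)
  · intro H j h1 h2
    exact (key ⟨j, h2.trans_le (sum_take_le l _)⟩).2 (H ⟨j, _⟩ h1 h2)

theorem isMaxPoint_iff (x : ℤ → ℝ) (q : ℤ) :
    IsMaxPoint x q ↔ Step x 0 (q - 1) ∧ Step x 1 q := by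
  simp [IsMaxPoint, Step]

theorem extremum_iff (x : ℤ → ℝ) (t : ℕ) (q : ℤ) :
    (if Even t then IsMinPoint x q else IsMaxPoint x q) ↔
      Step x (t + 1) (q - 1) ∧ Step x t q := by
  by_cases ht : Even t <;>
    simp [ht, IsMaxPoint, IsMinPoint, Step, Nat.even_add_one]

/-- Since the path already moves in direction `t + 1` at `p`, the first wanted extremum is the first
place where the direction changes. -/
theorem nextDist_eq_iff {x : ℤ → ℝ} (hx : ∀ j, x j ≠ x (j + 1)) {t : ℕ} {p : ℤ} {k : ℕ}
    (hk : 0 < k) (hp : Step x (t + 1) p) :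
    nextDist x t p = k ↔ (∀ j : ℕ, j < k → Step x (t + 1) (p + j)) ∧ Step x t (p + k) := by
  unfold nextDist
  simp only [extremum_iff]
  set S := {d : ℕ | 0 < d ∧ Step x (t + 1) (p + d - 1) ∧ Step x t (p + d)} with hS
  constructor
  · intro h
    have hmem : k ∈ S := by
      rw [← h]
      apply Nat.sInf_mem
      -- An empty set would give the default `sInf ∅ = 0`, contrary to `0 < k`.
      by_contra hne
      rw [Set.not_nonempty_iff_eq_empty] at hne
      rw [hne] at h
      simp at h
      omega
    refine ⟨fun j hj => ?_, hmem.2.2⟩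
    induction j with
    | zero => simpa using hp
    | succ j ih =>
      have h1 := ih (by omega)
      rcases step_or_step_succ (hx (p + (j + 1 : ℕ))) t with h2 | h2
      · have : j + 1 ∈ S := by
          refine ⟨by omega, ?_, h2⟩
          rwa [show p + ((j + 1 : ℕ) : ℤ) - 1 = p + j by push_cast; ring]
        have := Nat.sInf_le this
        omega
      · exact h2
  · rintro ⟨h1, h2⟩
    have hmem : k ∈ S := by
      refine ⟨hk, ?_, h2⟩
      have := h1 (k - 1) (by omega)
      rwa [show p + ((k - 1 : ℕ) : ℤ) = p + k - 1 by omega] at this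
    refine le_antisymm (Nat.sInf_le hmem) (le_csInf ⟨k, hmem⟩ ?_)
    rintro d ⟨-, -, hd⟩
    by_contra hlt
    exact not_step_succ hd (h1 d (by omega))

theorem step_of_run {x : ℤ → ℝ} {c : ℕ} {l : List ℕ} (hl : ∀ k ∈ l, 0 < k) {p : ℤ}
    (h : Run x c (l ++ [1]) p) : Step x c p := by
  cases l with
  | nil => simpa using h.1 0 one_pos
  | cons k l => simpa using h.1 0 (hl k (by simp))

/-- The step that certifies an extremum is the first step of the next run, which is nonempty. Only
the last extremum needs an extra step, the trailing `1`. -/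
theorem chain_iff_run {x : ℤ → ℝ} (hx : ∀ j, x j ≠ x (j + 1)) (l : List ℕ) :
    ∀ (t : ℕ) (p : ℤ), (∀ k ∈ l, 0 < k) → Step x (t + 1) p →
      (Chain x t p l ↔ Run x (t + 1) (l ++ [1]) p) := by
  induction l with
  | nil => intro t p _ hp; simpa [Chain, Run] using hp
  | cons k l ih =>
    intro t p hl hp
    have hl' : ∀ k ∈ l, 0 < k := fun k hk => hl k (by simp [hk])
    rw [Chain, List.cons_append, Run, nextDist_eq_iff hx (hl k (by simp)) hp]
    constructor
    · rintro ⟨⟨h1, h2⟩, h3⟩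
      exact ⟨h1, (ih (t + 1) _ hl' ((step_add_two ..).2 h2)).1 h3⟩
    · rintro ⟨h1, h2⟩
      have h3 := step_of_run hl' h2
      exact ⟨⟨h1, (step_add_two ..).1 h3⟩, (ih (t + 1) _ hl' h3).2 h2⟩

theorem forall_mu_eq_iff_chain (x : ℤ → ℝ) (n : ℕ) : ∀ (t : ℕ) (k : Fin n → ℕ),
    (∀ i : Fin n, mu x (t + i) = k i) ↔ Chain x t (extPoint x t) (List.ofFn k) := by
  induction n with
  | zero => intro t k; simp [Chain]
  | succ n ih =>
    intro t k
    rw [Fin.forall_fin_succ, List.ofFn_succ, Chain]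
    have h1 := ih (t + 1) fun i => k i.succ
    simp only [add_assoc, add_comm 1] at h1
    simp only [Fin.val_zero, add_zero, Fin.val_succ, h1]
    refine and_congr_right fun h => ?_
    rw [extPoint, ← h, mu]

theorem isMaxPoint_and_mu_eq_iff {x : ℤ → ℝ} (hx : ∀ j, x j ≠ x (j + 1)) (n : ℕ)
    (k : Fin n → ℕ) (hk : ∀ i, 0 < k i) :
    (IsMaxPoint x 0 ∧ ∀ i : Fin n, mu x i = k i) ↔ Run x 0 (1 :: (List.ofFn k ++ [1])) (-1) := by
  have hk' : ∀ m ∈ List.ofFn k, 0 < m := by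
    intro m hm
    obtain ⟨i, rfl⟩ := List.mem_ofFn.1 hm
    exact hk i
  have h := forall_mu_eq_iff_chain x n 0 k
  simp only [zero_add] at h
  rw [h, isMaxPoint_iff, Run]
  simp only [extPoint, zero_sub, Nat.lt_one_iff, forall_eq, Nat.cast_zero, add_zero, Nat.cast_one,
    neg_add_cancel, zero_add]
  constructor
  · rintro ⟨⟨h1, h2⟩, h3⟩
    exact ⟨h1, (chain_iff_run hx _ 0 0 hk' h2).1 h3⟩
  · rintro ⟨h1, h2⟩
    have h3 := step_of_run hk' h2
    exact ⟨⟨h1, h3⟩, (chain_iff_run hx _ 0 0 hk' h3).2 h2⟩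

theorem nextDist_pos {x : ℤ → ℝ} (hx : ∀ j, x j ≠ x (j + 1))
    (hrec : ∀ (c : ℕ) (p : ℤ), ∃ j : ℕ, Step x c (p + j)) (t : ℕ) (p : ℤ) :
    0 < nextDist x t p := by
  unfold nextDist
  simp only [extremum_iff]
  obtain ⟨j, hj⟩ := hrec (t + 1) p
  -- The first step of direction `t` at or after `p + j` is preceded by one of direction `t + 1`, so
  -- it starts at an extremum of the wanted kind.
  have hex := hrec t (p + j)
  classical
  have h1 := Nat.find_spec hex
  set d := Nat.find hex with hd
  have hd0 : d ≠ 0 := by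
    intro h0
    rw [h0] at h1
    exact not_step_succ (by simpa using h1) hj
  have h2 : ¬ Step x t (p + j + (d - 1 : ℕ)) := Nat.find_min hex (by omega)
  have h3 := (step_or_step_succ (hx _) t).resolve_left h2
  refine (Nat.sInf_mem (s := {d : ℕ | 0 < d ∧ _}) ⟨j + d, ?_⟩).1
  refine ⟨by omega, ?_, ?_⟩
  · rwa [show p + ((j + d : ℕ) : ℤ) - 1 = p + j + (d - 1 : ℕ) by omega]
  · rwa [show p + ((j + d : ℕ) : ℤ) = p + j + d by omega]

/-! ### Measurability of the distances -/

theorem measurableSet_step (c : ℕ) (j : ℤ) : MeasurableSet {x : ℤ → ℝ | Step x c j} := by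
  unfold Step
  split_ifs
  · exact measurableSet_lt (measurable_pi_apply _) (measurable_pi_apply _)
  · exact measurableSet_lt (measurable_pi_apply _) (measurable_pi_apply _)

theorem measurable_nextDist (t : ℕ) (p : ℤ) : Measurable fun x : ℤ → ℝ => nextDist x t p := by
  have hS : ∀ d : ℕ, MeasurableSet
      {x : ℤ → ℝ | 0 < d ∧ Step x (t + 1) (p + d - 1) ∧ Step x t (p + d)} := fun d =>
    (MeasurableSet.const _).inter ((measurableSet_step _ _).inter (measurableSet_step _ _))
  refine measurable_of_Iio fun n => ?_
  unfold nextDist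
  simp only [extremum_iff]
  -- The second alternative covers the default value 0 on the empty set.
  have : (fun x : ℤ → ℝ => sInf {d : ℕ | 0 < d ∧ Step x (t + 1) (p + d - 1) ∧ Step x t (p + d)})
      ⁻¹' Set.Iio n = {x | 0 < n ∧ ((∃ d < n, 0 < d ∧ Step x (t + 1) (p + d - 1) ∧
        Step x t (p + d)) ∨ ∀ d : ℕ, ¬ (0 < d ∧ Step x (t + 1) (p + d - 1) ∧
        Step x t (p + d)))} := by
    ext x
    simp only [Set.mem_preimage, Set.mem_Iio, Set.mem_ofPred_eq]
    set S := {d : ℕ | 0 < d ∧ Step x (t + 1) (p + d - 1) ∧ Step x t (p + d)} with hSdef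
    change _ ↔ 0 < n ∧ ((∃ d < n, d ∈ S) ∨ ∀ d, d ∉ S)
    constructor
    · intro h
      refine ⟨by omega, ?_⟩
      rcases S.eq_empty_or_nonempty with he | hne
      · right; simp [he]
      · exact Or.inl ⟨_, h, Nat.sInf_mem hne⟩
    · rintro ⟨hn, ⟨d, hd, hdS⟩ | h⟩
      · exact (Nat.sInf_le hdS).trans_lt hd
      · rw [Set.eq_empty_of_forall_notMem h]
        simpa using hn
  rw [this]
  have h1 := MeasurableSet.iUnion fun d : ℕ => MeasurableSet.iUnion fun _ : d < n => hS d
  have h2 := MeasurableSet.iInter fun d : ℕ => (hS d).compl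
  convert (MeasurableSet.const (0 < n)).inter (h1.union h2) using 1
  ext x
  simp only [Set.mem_inter_iff, Set.mem_union, Set.mem_iUnion, Set.mem_iInter, Set.mem_compl_iff,
    Set.mem_ofPred_eq, exists_prop]

theorem measurable_nextDist_comp (t : ℕ) {q : (ℤ → ℝ) → ℤ} (hq : Measurable q) :
    Measurable fun x : ℤ → ℝ => nextDist x t (q x) :=
  (measurable_from_prod_countable_left (f := fun y : (ℤ → ℝ) × ℤ => nextDist y.1 t y.2)
    fun p => measurable_nextDist t p).comp (measurable_id.prodMk hq)

theorem measurable_extPoint (t : ℕ) : Measurable fun x : ℤ → ℝ => extPoint x t := by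
  induction t with
  | zero => exact measurable_const
  | succ t ih =>
    exact ih.add ((measurable_of_countable (fun n : ℕ => (n : ℤ))).comp
      (measurable_nextDist_comp t ih))

theorem measurable_mu (t : ℕ) : Measurable fun x : ℤ → ℝ => mu x t :=
  measurable_nextDist_comp t (measurable_extPoint t)

end MonotoneRuns

namespace MonotoneRuns

/-! ### Order patterns of independent atomless variables -/

/-- Independent identically distributed real random variables whose distribution has no atoms. -/
structure IsAtomlessIID {Ω : Type*} [MeasurableSpace Ω] (P : Measure Ω) (X : ℤ → Ω → ℝ) :
    Prop where
  measurable : ∀ t, Measurable (X t)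
  indep : iIndepFun X P
  ident : ∀ t, P.map (X t) = P.map (X 0)
  atomless : ∀ a, P.map (X 0) {a} = 0

theorem measure_singleton_eq_zero_of_continuous_cdf (ν : Measure ℝ) [IsProbabilityMeasure ν]
    (h : Continuous (cdf ν)) (a : ℝ) : ν {a} = 0 := by
  have h1 : Function.leftLim (cdf ν) a = cdf ν a :=
    leftLim_eq_of_tendsto (h.continuousAt.tendsto.mono_left nhdsWithin_le_nhds)
  rw [← measure_cdf ν, StieltjesFunction.measure_singleton, h1, sub_self, ENNReal.ofReal_zero]

set_option linter.unusedSectionVars false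

variable {Ω : Type*} [MeasurableSpace Ω] {P : Measure Ω} [IsProbabilityMeasure P]
  {X : ℤ → Ω → ℝ}

namespace IsAtomlessIID

/-- By independence the pair has a product law, and each section of the diagonal is a single point,
hence null. -/
theorem ae_ne (h : IsAtomlessIID P X) {s t : ℤ} (hst : s ≠ t) : ∀ᵐ ω ∂P, X s ω ≠ X t ω := by
  have h1 := (indepFun_iff_map_prod_eq_prod_map_map (h.measurable s).aemeasurable
    (h.measurable t).aemeasurable).1 (h.indep.indepFun hst)
  have : IsProbabilityMeasure (P.map (X t)) :=
    Measure.isProbabilityMeasure_map (h.measurable t).aemeasurable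
  have hd : MeasurableSet {y : ℝ × ℝ | y.1 = y.2} :=
    measurableSet_eq_fun measurable_fst measurable_snd
  have h2 : (P.map fun ω => (X s ω, X t ω)) {y : ℝ × ℝ | y.1 = y.2} = 0 := by
    rw [h1, Measure.measure_prod_null hd]
    refine Filter.Eventually.of_forall fun a => ?_
    have : Prod.mk a ⁻¹' {y : ℝ × ℝ | y.1 = y.2} = {a} := by
      ext b; simp [eq_comm]
    change P.map (X t) (Prod.mk a ⁻¹' {y : ℝ × ℝ | y.1 = y.2}) = 0
    rw [this, h.ident t, h.atomless]
  rw [Measure.map_apply ((h.measurable s).prodMk (h.measurable t)) hd] at h2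
  rw [ae_iff]
  simpa using h2

theorem ae_injective (h : IsAtomlessIID P X) : ∀ᵐ ω ∂P, Function.Injective fun t => X t ω := by
  have : ∀ᵐ ω ∂P, ∀ s t : ℤ, s ≠ t → X s ω ≠ X t ω := by
    simp only [ae_all_iff]
    exact fun s t hst => h.ae_ne hst
  filter_upwards [this] with ω hω s t hst
  by_contra hne
  exact hω s t hne hst

theorem measurableSet_strictMono (N : ℕ) : MeasurableSet {y : Fin N → ℝ | StrictMono y} := by
  have : {y : Fin N → ℝ | StrictMono y} = ⋂ i, ⋂ j, ⋂ _ : i < j, {y | y i < y j} := by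
    ext; simp [StrictMono]
  rw [this]
  exact MeasurableSet.iInter fun i => MeasurableSet.iInter fun j => MeasurableSet.iInter fun _ =>
    measurableSet_lt (measurable_pi_apply _) (measurable_pi_apply _)

theorem map_eq_pi (h : IsAtomlessIID P X) {N : ℕ} {e : Fin N → ℤ} (he : Function.Injective e) :
    P.map (fun ω i => X (e i) ω) = Measure.pi fun _ => P.map (X 0) := by
  rw [iIndepFun.map_fun_eq_pi_map (fun i => (h.measurable (e i)).aemeasurable)
    (h.indep.precomp he)]
  simp only [h.ident]

theorem measurableSet_strictMono_comp (h : IsAtomlessIID P X) {N : ℕ} (e : Fin N → ℤ) :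
    MeasurableSet {ω | StrictMono fun i => X (e i) ω} :=
  (measurable_pi_lambda _ fun i => h.measurable (e i)) (measurableSet_strictMono N)

theorem exists_perm_strictMono {N : ℕ} {y : Fin N → ℝ} (hy : Function.Injective y) :
    ∃ σ : Equiv.Perm (Fin N), StrictMono (y ∘ σ) :=
  ⟨Tuple.sort y, (Tuple.monotone_sort y).strictMono_of_injective
    (hy.comp (Tuple.sort y).injective)⟩

theorem perm_unique_of_strictMono {N : ℕ} {y : Fin N → ℝ} (hy : Function.Injective y)
    {σ τ : Equiv.Perm (Fin N)} (hσ : StrictMono (y ∘ σ)) (hτ : StrictMono (y ∘ τ)) : σ = τ := by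
  have := Tuple.unique_monotone hσ.monotone hτ.monotone
  ext i
  exact congrArg Fin.val (hy (congrFun this i))

/-- The N! possible orderings are equally likely because the product law does not depend on the
labelling. Without ties they are disjoint and exhaust the space. -/
theorem prob_strictMono (h : IsAtomlessIID P X) {N : ℕ} {e : Fin N → ℤ}
    (he : Function.Injective e) :
    P.real {ω | StrictMono fun i => X (e i) ω} = 1 / (N.factorial : ℝ) := by
  set A : Equiv.Perm (Fin N) → Set Ω := fun σ => {ω | StrictMono fun i => X (e (σ i)) ω} with hA
  have hmeas : ∀ σ, MeasurableSet (A σ) := fun σ => h.measurableSet_strictMono_comp _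
  have heq : ∀ σ, P.real (A σ) = P.real {ω | StrictMono fun i => X (e i) ω} := by
    intro σ
    have h1 : ∀ e : Fin N → ℤ, Function.Injective e → P {ω | StrictMono fun i => X (e i) ω} =
        (Measure.pi fun _ : Fin N => P.map (X 0)) {y | StrictMono y} := by
      intro e he
      rw [← h.map_eq_pi he, Measure.map_apply
        (measurable_pi_lambda _ fun i => h.measurable (e i)) (measurableSet_strictMono N)]
      rfl
    rw [measureReal_def, measureReal_def, h1 _ he]
    exact congrArg _ (h1 _ (he.comp σ.injective))
  have hdisj : Pairwise (Function.onFun (AEDisjoint P) A) := by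
    intro σ τ hne
    refine measure_mono_null (t := {ω | ¬ Function.Injective fun t => X t ω}) ?_
      (ae_iff.1 h.ae_injective)
    rintro ω ⟨h1, h2⟩ hinj
    exact hne (perm_unique_of_strictMono (hinj.comp he) h1 h2)
  have hcover : P.real (⋃ σ, A σ) = 1 := by
    rw [measureReal_def, prob_compl_eq_zero_iff (MeasurableSet.iUnion hmeas) |>.1, ENNReal.toReal_one]
    refine measure_mono_null ?_ (ae_iff.1 h.ae_injective)
    intro ω hω hinj
    obtain ⟨σ, hσ⟩ := exists_perm_strictMono (hinj.comp he)
    exact hω (Set.mem_iUnion.2 ⟨σ, hσ⟩)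
  have hsum : P.real (⋃ σ, A σ) = ∑ σ, P.real (A σ) := by
    simp only [measureReal_def]
    rw [measure_iUnion₀ hdisj fun σ => (hmeas σ).nullMeasurableSet, tsum_fintype,
      ENNReal.toReal_sum (by simp)]
  rw [hcover] at hsum
  simp only [heq, Finset.sum_const, Finset.card_univ, Fintype.card_perm, Fintype.card_fin,
    nsmul_eq_mul] at hsum
  rw [eq_div_iff (by positivity), hsum]
  ring

theorem ae_succ_ne (h : IsAtomlessIID P X) : ∀ᵐ ω ∂P, ∀ j : ℤ, X j ω ≠ X (j + 1) ω := by
  filter_upwards [h.ae_injective] with ω hω j hj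
  have := hω hj
  omega

theorem measurable_path (h : IsAtomlessIID P X) : Measurable fun ω t => X t ω :=
  measurable_pi_lambda _ h.measurable

theorem measurableSet_step (h : IsAtomlessIID P X) (c : ℕ) (j : ℤ) :
    MeasurableSet {ω | Step (fun t => X t ω) c j} :=
  h.measurable_path (MonotoneRuns.measurableSet_step c j)

theorem measurableSet_run (h : IsAtomlessIID P X) (c : ℕ) (l : List ℕ) (p : ℤ) :
    MeasurableSet {ω | Run (fun t => X t ω) c l p} := by
  induction l generalizing c p with
  | nil => simp [Run]
  | cons k l ih =>
    have h1 := MeasurableSet.iInter fun j : ℕ => MeasurableSet.iInter fun _ : j < k =>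
      h.measurableSet_step c (p + j)
    convert h1.inter (ih (c + 1) (p + k)) using 1
    ext ω
    simp [Run]

theorem prob_run (h : IsAtomlessIID P X) (l : List ℕ) (p : ℤ) :
    P.real {ω | Run (fun t => X t ω) 0 l p} = Omega' l := by
  classical
  set e : Fin (l.sum + 1) → ℤ := fun i => p + (i : ℕ) with he'
  have he : Function.Injective e := by
    intro i j hij
    ext
    simp only [e] at hij
    omega
  -- On `A τ` the rank of the `i`-th variable is `τ i`, so listing the variables along `τ.symm`
  -- sorts them.
  set A : Equiv.Perm (Fin (l.sum + 1)) → Set Ω :=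
    fun τ => {ω | StrictMono fun i => X (e (τ.symm i)) ω} with hA
  have hmeas : ∀ τ, MeasurableSet (A τ) := fun τ => h.measurableSet_strictMono_comp _
  have hord : ∀ τ, ∀ ω ∈ A τ, Run (fun t => X t ω) 0 l p ↔ HasRuns l τ := by
    intro τ ω hω
    refine run_iff_hasRuns fun i j => ?_
    have := StrictMono.lt_iff_lt hω (a := τ i) (b := τ j)
    simpa using this
  have hae : {ω | Run (fun t => X t ω) 0 l p} =ᵐ[P]
      ⋃ τ ∈ Finset.univ.filter (HasRuns l), A τ := by
    filter_upwards [h.ae_injective] with ω hinj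
    obtain ⟨σ, hσ⟩ := exists_perm_strictMono (hinj.comp he)
    refine propext ⟨fun hr => ?_, fun hr => ?_⟩
    · exact Set.mem_iUnion₂.2 ⟨σ.symm, by simpa using (hord σ.symm ω hσ).1 hr, hσ⟩
    · obtain ⟨τ, hτ, hω⟩ := Set.mem_iUnion₂.1 hr
      exact (hord τ ω hω).2 (by simpa using hτ)
  rw [measureReal_congr hae, measureReal_biUnion_finset₀ ?_ fun τ _ => (hmeas τ).nullMeasurableSet]
  · have : ∀ τ, P.real (A τ) = 1 / ((l.sum + 1).factorial : ℝ) := fun τ =>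
      h.prob_strictMono (he.comp τ.symm.injective)
    simp only [this, Finset.sum_const, nsmul_eq_mul, Omega', Omega]
    rw [mul_one_div]
  · intro σ _ τ _ hne
    refine measure_mono_null (t := {ω | ¬ Function.Injective fun t => X t ω}) ?_
      (ae_iff.1 h.ae_injective)
    rintro ω ⟨h1, h2⟩ hinj
    have := perm_unique_of_strictMono (hinj.comp he) h1 h2
    exact hne (Equiv.symm_bijective.injective this)

theorem prob_monotone_run (h : IsAtomlessIID P X) (c : ℕ) (p : ℤ) (m : ℕ) :
    P.real {ω | ∀ j : ℕ, j < m → Step (fun t => X t ω) c (p + j)} =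
      1 / ((m + 1).factorial : ℝ) := by
  by_cases hc : Even c
  · rw [← h.prob_strictMono (e := fun i : Fin (m + 1) => p + (i : ℕ))
      (fun i j hij => by ext; simp only at hij; omega)]
    congr 1
    ext ω
    simp only [Set.mem_ofPred_eq, Fin.strictMono_iff_lt_succ, Step, hc, if_true]
    constructor
    · intro H i
      simpa [add_assoc] using H i i.2
    · intro H j hj
      simpa [add_assoc] using H ⟨j, hj⟩
  -- A descending run is an ascending one read backwards from its right end.
  · rw [← h.prob_strictMono (e := fun i : Fin (m + 1) => p + m - (i : ℕ))
      (fun i j hij => by ext; simp only at hij; omega)]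
    congr 1
    ext ω
    simp only [Set.mem_ofPred_eq, Fin.strictMono_iff_lt_succ, Step, hc, if_false,
      Fin.val_castSucc, Fin.val_succ]
    constructor
    · intro H i
      have := H (m - 1 - i) (by omega)
      rwa [show p + ((m - 1 - i : ℕ) : ℤ) + 1 = p + m - (i : ℕ) by omega,
        show p + ((m - 1 - i : ℕ) : ℤ) = p + m - ((i : ℕ) + 1 : ℕ) by omega] at this
    · intro H j hj
      have := H ⟨m - 1 - j, by omega⟩
      dsimp only at this
      rwa [show p + m - ((m - 1 - j : ℕ) : ℤ) = p + j + 1 by omega,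
        show p + m - ((m - 1 - j + 1 : ℕ) : ℤ) = p + j by omega] at this

/-- If a direction never occurred from `p` on, then for every m the next m steps would all go the
other way, which has probability 1/(m+1)!. -/
theorem ae_exists_step (h : IsAtomlessIID P X) :
    ∀ᵐ ω ∂P, ∀ (c : ℕ) (p : ℤ), ∃ j : ℕ, Step (fun t => X t ω) c (p + j) := by
  simp only [ae_all_iff]
  intro c p
  have key : P.real {ω | ∀ j : ℕ, Step (fun t => X t ω) (c + 1) (p + j)} = 0 := by
    refine le_antisymm (ge_of_tendsto' (f := fun m : ℕ => 1 / (((m + 1).factorial : ℕ) : ℝ))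
      (x := Filter.atTop) ?_ fun m => ?_) measureReal_nonneg
    · refine squeeze_zero (fun _ => by positivity) (fun m => ?_)
        tendsto_one_div_add_atTop_nhds_zero_nat
      gcongr
      exact_mod_cast Nat.self_le_factorial _
    · rw [← h.prob_monotone_run (c + 1) p m]
      exact measureReal_mono fun ω hω j _ => hω j
  rw [measureReal_eq_zero_iff] at key
  filter_upwards [measure_eq_zero_iff_ae_notMem.1 key, h.ae_succ_ne] with ω h1 h2
  by_contra hne
  push Not at hne
  exact h1 fun j => (step_or_step_succ (x := fun t => X t ω) (h2 _) c).resolve_left (hne j)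

/-! ### Valleys: descents followed by ascents -/

/-- The probability of `k` descents followed by `l` ascents. -/
theorem prob_valley (h : IsAtomlessIID P X) (l : ℕ) : ∀ (k : ℕ) (p : ℤ),
    P.real {ω | Run (fun t => X t ω) 1 [k, l] p} =
      1 / ((k + l + 1) * k.factorial * l.factorial : ℝ) := by
  induction l with
  | zero =>
    intro k p
    have := h.prob_monotone_run 1 p k
    simp only [Run, Nat.not_lt_zero, false_imp_iff, implies_true, and_true]
    rw [this, Nat.factorial_succ]
    simp
  | succ l ih =>
    intro k p
    -- With the step from `p + k` to `p + k + 1` left free, the two blocks depend on disjoint sets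
    -- of variables.
    have hind : P.real ({ω | ∀ j : ℕ, j < k → Step (fun t => X t ω) 1 (p + j)} ∩
        {ω | ∀ j : ℕ, j < l → Step (fun t => X t ω) 0 (p + k + 1 + j)}) =
        1 / ((k + 1).factorial : ℝ) * (1 / ((l + 1).factorial : ℝ)) := by
      rw [← h.prob_monotone_run 1 p k, ← h.prob_monotone_run 0 (p + k + 1) l]
      have hI := indep_iSup_of_disjoint (m := fun t => MeasurableSpace.comap (X t) inferInstance)
        (fun t => (h.measurable t).comap_le) h.indep
        (S := Set.Iic (p + k)) (T := Set.Ioi (p + k)) (Set.Iic_disjoint_Ioi le_rfl)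
      have hmeas : ∀ (S : Set ℤ) (t : ℤ), t ∈ S →
          Measurable[⨆ n ∈ S, MeasurableSpace.comap (X n) inferInstance] (X t) := by
        intro S t ht
        refine Measurable.mono (comap_measurable (X t)) ?_ le_rfl
        exact le_iSup₂ (f := fun n (_ : n ∈ S) =>
          MeasurableSpace.comap (X n) (inferInstance : MeasurableSpace ℝ)) t ht
      have hst : ∀ (S : Set ℤ) (c : ℕ) (q : ℤ) (m : ℕ), (∀ j : ℕ, j ≤ m → q + j ∈ S) →
          MeasurableSet[⨆ n ∈ S, MeasurableSpace.comap (X n) inferInstance]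
            {ω | ∀ j : ℕ, j < m → Step (fun t => X t ω) c (q + j)} := by
        intro S c q m hS
        have : {ω | ∀ j : ℕ, j < m → Step (fun t => X t ω) c (q + j)} =
            ⋂ j : ℕ, ⋂ _ : j < m, {ω | Step (fun t => X t ω) c (q + j)} := by
          ext; simp
        rw [this]
        refine MeasurableSet.iInter fun j => MeasurableSet.iInter fun hj => ?_
        have m1 := hmeas S (q + j) (hS j hj.le)
        have m2 := hmeas S (q + j + 1) (by simpa [add_assoc] using hS (j + 1) hj)
        unfold Step
        split_ifs
        · exact measurableSet_lt m1 m2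
        · exact measurableSet_lt m2 m1
      have := (Indep_iff _ _ P).1 hI _ _ (hst _ 1 p k fun j hj => by simp; omega)
        (hst _ 0 (p + k + 1) l fun j hj => by simp; omega)
      rw [measureReal_def, this, ENNReal.toReal_mul]
      rfl
    -- The free middle step joins the ascents if it goes up and the descents if it goes down.
    have hsplit : P.real {ω | Run (fun t => X t ω) 1 [k, l + 1] p} +
        P.real {ω | Run (fun t => X t ω) 1 [k + 1, l] p} =
        P.real ({ω | ∀ j : ℕ, j < k → Step (fun t => X t ω) 1 (p + j)} ∩
          {ω | ∀ j : ℕ, j < l → Step (fun t => X t ω) 0 (p + k + 1 + j)}) := by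
      rw [← measureReal_union₀ (h.measurableSet_run 1 [k + 1, l] p).nullMeasurableSet]
      · refine measureReal_congr ?_
        filter_upwards [h.ae_succ_ne] with ω hne
        refine propext ⟨?_, ?_⟩
        · rintro (⟨h1, h2, -⟩ | ⟨h1, h2, -⟩)
          · exact ⟨h1, fun j hj => by
              have := h2 (j + 1) (by omega)
              rw [step_add_two] at this
              convert this using 1; push_cast; ring⟩
          · exact ⟨fun j hj => h1 j (by omega), fun j hj => by
              have := h2 j hj
              rw [step_add_two] at this
              convert this using 1; push_cast; ring⟩
        · rintro ⟨h1, h2⟩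
          rcases step_or_step_succ (x := fun t => X t ω) (hne (p + k)) 0 with h3 | h3
          · refine Or.inl ⟨h1, fun j hj => (step_add_two ..).2 ?_, trivial⟩
            rcases j with _ | j
            · simpa using h3
            · have := h2 j (by omega)
              convert this using 1; push_cast; ring
          · refine Or.inr ⟨fun j hj => ?_, fun j hj => (step_add_two ..).2 ?_, trivial⟩
            · rcases Nat.lt_succ_iff_lt_or_eq.1 hj with hj | rfl
              · exact h1 j hj
              · exact h3
            · have := h2 j hj
              convert this using 1; push_cast; ring
      · refine Disjoint.aedisjoint (Set.disjoint_left.2 ?_)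
        rintro ω ⟨-, h1, -⟩ ⟨h2, -⟩
        refine not_step_succ ((step_add_two ..).1 ?_) (h2 k (by omega))
        simpa using h1 0 (by omega)
    rw [hind, ih] at hsplit
    rw [eq_sub_of_add_eq hsplit]
    have f1 : ((k.factorial : ℕ) : ℝ) ≠ 0 := by positivity
    have f2 : ((l.factorial : ℕ) : ℝ) ≠ 0 := by positivity
    have f3 : (k : ℝ) + l + 2 ≠ 0 := by positivity
    rw [Nat.factorial_succ, Nat.factorial_succ]
    push_cast
    have e1 : (k : ℝ) + 1 + l + 1 = k + l + 2 := by ring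
    have e2 : (k : ℝ) + (l + 1) + 1 = k + l + 2 := by ring
    rw [e1, e2]
    field_simp
    ring

end IsAtomlessIID
end MonotoneRuns

namespace MonotoneRuns

/-! ### Valley probabilities and their differences -/

/-- The probability that `k` descents are followed by `l` ascents. -/
noncomputable def valleyProb (k l : ℕ) : ℝ := 1 / ((k + l + 1) * k.factorial * l.factorial)

theorem valleyProb_nonneg (k l : ℕ) : 0 ≤ valleyProb k l := by
  unfold valleyProb; positivity

theorem valleyProb_comm (k l : ℕ) : valleyProb k l = valleyProb l k := by
  unfold valleyProb; congr 1; ring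

theorem valleyProb_le (k l : ℕ) : valleyProb k l ≤ 1 / ((k : ℝ) + 1) := by
  unfold valleyProb
  have h1 : (1 : ℝ) ≤ k.factorial := by exact_mod_cast Nat.one_le_iff_ne_zero.2 k.factorial_ne_zero
  have h2 : (1 : ℝ) ≤ l.factorial := by exact_mod_cast Nat.one_le_iff_ne_zero.2 l.factorial_ne_zero
  have h3 : (1 : ℝ) ≤ k.factorial * l.factorial := one_le_mul_of_one_le_of_one_le h1 h2
  have h4 : (0 : ℝ) ≤ l := by positivity
  refine one_div_le_one_div_of_le (by positivity) ?_
  rw [mul_assoc]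
  nlinarith [mul_le_mul_of_nonneg_left h3 (by positivity : (0 : ℝ) ≤ (k : ℝ) + l + 1)]

theorem tendsto_valleyProb_left (l : ℕ) :
    Filter.Tendsto (fun k => valleyProb k l) Filter.atTop (nhds 0) :=
  squeeze_zero (fun k => valleyProb_nonneg k l) (fun k => valleyProb_le k l)
    tendsto_one_div_add_atTop_nhds_zero_nat

theorem tendsto_valleyProb_right (k : ℕ) :
    Filter.Tendsto (fun l => valleyProb k l) Filter.atTop (nhds 0) := by
  simpa only [valleyProb_comm k] using tendsto_valleyProb_left k

theorem valleyProb_one_right (k : ℕ) :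
    valleyProb k 1 = 1 / ((k + 1).factorial : ℝ) - 1 / ((k + 2).factorial : ℝ) := by
  unfold valleyProb
  rw [Nat.factorial_succ (k + 1), Nat.factorial_succ k]
  have : ((k.factorial : ℕ) : ℝ) ≠ 0 := by positivity
  push_cast
  field_simp
  simp

/-- The step after the last run either prolongs it or reverses direction. -/
theorem run_concat_or {x : ℤ → ℝ} (hx : ∀ j, x j ≠ x (j + 1)) (l : List ℕ) (k : ℕ) :
    ∀ (c : ℕ) (p : ℤ), Run x c (l ++ [k]) p ↔
      (Run x c (l ++ [k + 1]) p ∨ Run x c (l ++ [k, 1]) p) := by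
  induction l with
  | nil =>
    intro c p
    simp only [List.nil_append, Run, and_true, Nat.lt_one_iff, forall_eq, Nat.cast_zero, add_zero]
    constructor
    · intro h
      rcases step_or_step_succ (hx (p + k)) c with h1 | h1
      · refine Or.inl fun j hj => ?_
        rcases Nat.lt_succ_iff_lt_or_eq.1 hj with hj | rfl
        · exact h j hj
        · exact h1
      · exact Or.inr ⟨h, h1⟩
    · rintro (h | h)
      · exact fun j hj => h j (by omega)
      · exact h.1
  | cons m l ih =>
    intro c p
    simp only [List.cons_append, Run, ih (c + 1) (p + m), and_or_left]

theorem not_run_concat_and {x : ℤ → ℝ} (l : List ℕ) (k : ℕ) :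
    ∀ (c : ℕ) (p : ℤ), ¬ (Run x c (l ++ [k + 1]) p ∧ Run x c (l ++ [k, 1]) p) := by
  induction l with
  | nil =>
    rintro c p ⟨⟨h1, -⟩, -, h2, -⟩
    exact not_step_succ (h1 k (by omega)) (by simpa using h2 0 one_pos)
  | cons m l ih =>
    rintro c p ⟨⟨-, h1⟩, -, h2⟩
    exact ih _ _ ⟨h1, h2⟩

theorem run_cons_or {x : ℤ → ℝ} (hx : ∀ j, x j ≠ x (j + 1)) (l : List ℕ) (k c : ℕ) (p : ℤ) :
    Run x (c + 1) (k :: l) (p + 1) ↔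
      (Run x c (1 :: k :: l) p ∨ Run x (c + 1) ((k + 1) :: l) p) := by
  have e : p + ((k + 1 : ℕ) : ℤ) = p + 1 + k := by push_cast; ring
  simp only [Run, e, Nat.lt_one_iff, forall_eq, Nat.cast_zero, add_zero, Nat.cast_one]
  constructor
  · rintro ⟨h1, h2⟩
    rcases step_or_step_succ (hx p) c with h3 | h3
    · exact Or.inl ⟨h3, h1, h2⟩
    · refine Or.inr ⟨fun j hj => ?_, h2⟩
      rcases j with _ | j
      · simpa using h3
      · have := h1 j (by omega)
        rwa [show p + ((j + 1 : ℕ) : ℤ) = p + 1 + j by push_cast; ring]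
  · rintro (⟨-, h⟩ | ⟨h1, h2⟩)
    · exact h
    · refine ⟨fun j hj => ?_, h2⟩
      have := h1 (j + 1) (by omega)
      rwa [show p + ((j + 1 : ℕ) : ℤ) = p + 1 + j by push_cast; ring] at this

theorem not_run_cons_and {x : ℤ → ℝ} (l : List ℕ) (k c : ℕ) (p : ℤ) :
    ¬ (Run x c (1 :: k :: l) p ∧ Run x (c + 1) ((k + 1) :: l) p) := by
  rintro ⟨⟨h1, -⟩, h2, -⟩
  exact not_step_succ (h1 0 one_pos) (h2 0 (by omega))

section iid

variable {Ω : Type*} [MeasurableSpace Ω] {P : Measure Ω} [IsProbabilityMeasure P]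
  {X : ℤ → Ω → ℝ}

namespace IsAtomlessIID

theorem prob_run_concat (h : IsAtomlessIID P X) (l : List ℕ) (k c : ℕ) (p : ℤ) :
    P.real {ω | Run (fun t => X t ω) c (l ++ [k]) p} =
      P.real {ω | Run (fun t => X t ω) c (l ++ [k + 1]) p} +
      P.real {ω | Run (fun t => X t ω) c (l ++ [k, 1]) p} := by
  have hd : Disjoint {ω | Run (fun t => X t ω) c (l ++ [k + 1]) p}
      {ω | Run (fun t => X t ω) c (l ++ [k, 1]) p} :=
    Set.disjoint_left.2 fun ω h1 h2 => not_run_concat_and _ _ _ _ ⟨h1, h2⟩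
  rw [← measureReal_union hd (h.measurableSet_run _ _ _)]
  refine measureReal_congr ?_
  filter_upwards [h.ae_succ_ne] with ω hω
  exact propext (run_concat_or (x := fun t => X t ω) hω l k c p)

theorem prob_run_cons (h : IsAtomlessIID P X) (l : List ℕ) (k c : ℕ) (p : ℤ) :
    P.real {ω | Run (fun t => X t ω) (c + 1) (k :: l) (p + 1)} =
      P.real {ω | Run (fun t => X t ω) c (1 :: k :: l) p} +
      P.real {ω | Run (fun t => X t ω) (c + 1) ((k + 1) :: l) p} := by
  have hd : Disjoint {ω | Run (fun t => X t ω) c (1 :: k :: l) p}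
      {ω | Run (fun t => X t ω) (c + 1) ((k + 1) :: l) p} :=
    Set.disjoint_left.2 fun ω h1 h2 => not_run_cons_and _ _ _ _ ⟨h1, h2⟩
  rw [← measureReal_union hd (h.measurableSet_run _ _ _)]
  refine measureReal_congr ?_
  filter_upwards [h.ae_succ_ne] with ω hω
  exact propext (run_cons_or (x := fun t => X t ω) hω l k c p)

/-- A valley starts at a peak unless its descent extends one step to the left, and ends at one
unless its ascent extends one step to the right. Each exclusion is a difference. -/
theorem prob_peak_valley_peak (h : IsAtomlessIID P X) (k l : ℕ) (p : ℤ) :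
    P.real {ω | Run (fun t => X t ω) 0 [1, k, l, 1] p} =
      valleyProb k l - valleyProb (k + 1) l -
        (valleyProb k (l + 1) - valleyProb (k + 1) (l + 1)) := by
  have hV : ∀ (k l : ℕ) (p : ℤ), P.real {ω | Run (fun t => X t ω) (0 + 1) [k, l] p} =
    valleyProb k l := fun k l p => h.prob_valley l k p
  have hU : ∀ l, P.real {ω | Run (fun t => X t ω) 0 [1, k, l] p} =
      valleyProb k l - valleyProb (k + 1) l := by
    intro l
    have := h.prob_run_cons [l] k 0 p
    rw [hV, hV] at this
    linarith
  have := h.prob_run_concat [1, k] l 0 p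
  simp only [List.cons_append, List.nil_append] at this
  rw [hU, hU] at this
  linarith

theorem prob_isMaxPoint (h : IsAtomlessIID P X) :
    P.real {ω | IsMaxPoint (fun t => X t ω) 0} = 1 / 3 := by
  -- An ascent is followed by a descent with probability 1/2! - 1/3!.
  have h1 := h.prob_run_concat [] 1 0 (-1)
  have h2 := h.prob_monotone_run 0 (-1)
  have h3 : {ω | IsMaxPoint (fun t => X t ω) 0} =
      {ω | Run (fun t => X t ω) 0 ([] ++ [1, 1]) (-1)} := by
    ext ω
    simp [isMaxPoint_iff, Run]
  rw [h3]
  simp only [List.nil_append, Run, and_true] at h1 ⊢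
  rw [h2, h2] at h1
  norm_num [Nat.factorial] at h1 ⊢
  linarith

end IsAtomlessIID
end iid

/-! ### Tail sums and the exponential series -/

section moments

set_option linter.unusedSectionVars false

variable {Ω : Type*} [MeasurableSpace Ω] {Q : Measure Ω} [IsProbabilityMeasure Q]

theorem measureReal_tail_of_telescoping {A : Set Ω} (hA : MeasurableSet A) {Y : Ω → ℕ}
    (hY : Measurable Y) {g : ℕ → ℝ} (hg : Filter.Tendsto g Filter.atTop (nhds 0)) (i : ℕ)
    (h : ∀ k, i < k → Q.real (A ∩ {ω | Y ω = k}) = g k - g (k + 1)) :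
    Q.real (A ∩ {ω | i < Y ω}) = g (i + 1) := by
  have hU : A ∩ {ω | i < Y ω} = ⋃ n, A ∩ {ω | Y ω = i + 1 + n} := by
    ext ω
    simp only [Set.mem_inter_iff, Set.mem_ofPred_eq, Set.mem_iUnion, exists_and_left]
    refine and_congr_right fun _ => ⟨fun h => ⟨Y ω - (i + 1), by omega⟩, ?_⟩
    rintro ⟨n, hn⟩
    omega
  have hm : ∀ n, MeasurableSet (A ∩ {ω | Y ω = i + 1 + n}) := fun n =>
    hA.inter (hY (measurableSet_singleton _))
  have hd : Pairwise (Function.onFun Disjoint fun n => A ∩ {ω | Y ω = i + 1 + n}) := by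
    intro m n hmn
    refine Set.disjoint_left.2 ?_
    rintro ω ⟨-, h1⟩ ⟨-, h2⟩
    simp only [Set.mem_ofPred_eq] at h1 h2
    omega
  have h1 : Q (A ∩ {ω | i < Y ω}) = ∑' n, Q (A ∩ {ω | Y ω = i + 1 + n}) := by
    rw [hU, measure_iUnion hd hm]
  have h2 : ∑' n, Q (A ∩ {ω | Y ω = i + 1 + n}) ≠ ⊤ := h1 ▸ measure_ne_top _ _
  have h3 := ENNReal.hasSum_toReal h2
  rw [← ENNReal.tsum_toReal_eq (fun n => measure_ne_top _ _), ← h1] at h3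
  refine tendsto_nhds_unique h3.tendsto_sum_nat ?_
  have h4 : ∀ N, ∑ n ∈ Finset.range N, (Q (A ∩ {ω | Y ω = i + 1 + n})).toReal =
      g (i + 1) - g (i + 1 + N) := by
    intro N
    rw [← Finset.sum_range_sub' (fun n => g (i + 1 + n))]
    exact Finset.sum_congr rfl fun n _ => h (i + 1 + n) (by omega)
  simp only [h4]
  have h5 : Filter.Tendsto (fun N => g (i + 1 + N)) Filter.atTop (nhds 0) :=
    hg.comp (Filter.tendsto_atTop_mono (fun N => by simp) Filter.tendsto_id)
  simpa using h5.const_sub (g (i + 1))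

theorem hasSum_indicator_of_finset {Ω ι : Type*} {A : ι → Set Ω} {c : ι → ℝ} {ω : Ω} (s : Finset ι)
    (hs : ∀ i, ω ∈ A i ↔ i ∈ s) {v : ℝ} (hv : ∑ i ∈ s, c i = v) :
    HasSum (fun i => (A i).indicator (fun _ => c i) ω) v := by
  have h1 : ∀ i ∉ s, (A i).indicator (fun _ => c i) ω = 0 := fun i hi =>
    Set.indicator_of_notMem (fun h => hi ((hs i).1 h)) _
  have h2 := hasSum_sum_of_ne_finset_zero (L := SummationFilter.unconditional ι) h1
  rwa [Finset.sum_congr rfl fun i hi => Set.indicator_of_mem ((hs i).2 hi) _, hv] at h2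

/-- Tail-sum formula: termwise integration of a nonnegative series gives both finiteness and value,
with no prior integrability assumption. -/
theorem integrable_and_integral_eq_of_hasSum_indicator {ι : Type*} [Countable ι]
    {A : ι → Set Ω} (hA : ∀ i, MeasurableSet (A i)) {c : ι → ℝ} (hc : ∀ i, 0 ≤ c i)
    {f : Ω → ℝ} (hf : Measurable f)
    (hsum : ∀ ω, HasSum (fun i => (A i).indicator (fun _ => c i) ω) (f ω)) {s : ℝ}
    (hs : HasSum (fun i => c i * Q.real (A i)) s) :
    Integrable f Q ∧ ∫ ω, f ω ∂Q = s := by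
  have hnn : ∀ i ω, 0 ≤ (A i).indicator (fun _ => c i) ω := fun i ω =>
    Set.indicator_nonneg (fun _ _ => hc i) ω
  have hf0 : ∀ ω, 0 ≤ f ω := fun ω => (hsum ω).nonneg fun i => hnn i ω
  have hs0 : 0 ≤ s := hs.nonneg fun i => mul_nonneg (hc i) measureReal_nonneg
  have h1 : ∫⁻ ω, ENNReal.ofReal (f ω) ∂Q = ENNReal.ofReal s := by
    have e1 : ∀ ω, ENNReal.ofReal (f ω) =
        ∑' i, ENNReal.ofReal ((A i).indicator (fun _ => c i) ω) := by
      intro ω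
      rw [← (hsum ω).tsum_eq, ENNReal.ofReal_tsum_of_nonneg (fun i => hnn i ω) (hsum ω).summable]
    have e2 : ∀ i, ∫⁻ ω, ENNReal.ofReal ((A i).indicator (fun _ => c i) ω) ∂Q =
        ENNReal.ofReal (c i * Q.real (A i)) := by
      intro i
      have : (fun ω => ENNReal.ofReal ((A i).indicator (fun _ => c i) ω)) =
          (A i).indicator fun _ => ENNReal.ofReal (c i) := by
        ext ω
        by_cases hω : ω ∈ A i <;> simp [hω]
      rw [this, lintegral_indicator_const (hA i), ENNReal.ofReal_mul (hc i), measureReal_def,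
        ENNReal.ofReal_toReal (measure_ne_top _ _)]
    simp only [e1]
    rw [lintegral_tsum fun i =>
      ((measurable_const.indicator (hA i)).ennreal_ofReal).aemeasurable]
    simp only [e2]
    rw [← ENNReal.ofReal_tsum_of_nonneg (fun i => mul_nonneg (hc i) measureReal_nonneg)
      hs.summable, hs.tsum_eq]
  constructor
  · refine ⟨hf.aestronglyMeasurable, ?_⟩
    rw [hasFiniteIntegral_iff_ofReal (Filter.Eventually.of_forall hf0), h1]
    exact ENNReal.ofReal_lt_top
  · rw [integral_eq_lintegral_of_nonneg_ae (Filter.Eventually.of_forall hf0)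
      hf.aestronglyMeasurable, h1, ENNReal.toReal_ofReal hs0]

theorem hasSum_one_div_factorial_add (m : ℕ) :
    HasSum (fun n : ℕ => 1 / ((n + m).factorial : ℝ))
      (Real.exp 1 - ∑ i ∈ Finset.range m, 1 / (i.factorial : ℝ)) := by
  have := NormedSpace.expSeries_div_hasSum_exp (1 : ℝ)
  rw [← Real.exp_eq_exp_ℝ] at this
  simp only [one_pow] at this
  exact (hasSum_nat_add_iff' m).2 this

theorem hasSum_tail :
    HasSum (fun i : ℕ => 1 * (3 * valleyProb (i + 1) 1)) (3 / 2) := by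
  have h := ((hasSum_one_div_factorial_add 2).sub (hasSum_one_div_factorial_add 3)).mul_left 3
  convert! h using 1
  · ext i
    rw [valleyProb_one_right, one_mul]
  · norm_num [Finset.sum_range_succ, Nat.factorial]

theorem hasSum_sq_tail :
    HasSum (fun i : ℕ => (2 * i + 1 : ℝ) * (3 * valleyProb (i + 1) 1))
      (6 * Real.exp 1 - 27 / 2) := by
  -- The term without the factor 3 is (2i+1)(i+2)/(i+3)!. With n = i+3 its numerator is 2n(n-1) - 5n
  -- + 5, whence the coefficients 2, -5, 5.
  have h := ((((hasSum_one_div_factorial_add 1).mul_left 2).sub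
    ((hasSum_one_div_factorial_add 2).mul_left 5)).add
    ((hasSum_one_div_factorial_add 3).mul_left 5)).mul_left 3
  convert! h using 1
  · ext i
    rw [valleyProb_one_right, Nat.factorial_succ (i + 2), Nat.factorial_succ (i + 1)]
    have : (((i + 1).factorial : ℕ) : ℝ) ≠ 0 := by positivity
    push_cast
    field_simp
    ring
  · norm_num [Finset.sum_range_succ, Nat.factorial]
    ring

/-- Here V(k,l) = C(k+l,k)/(k+l+1)!, and the sum runs over row n+2 of Pascal's triangle without its
two end entries. -/
theorem sum_antidiagonal_valleyProb (n : ℕ) :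
    ∑ q ∈ Finset.HasAntidiagonal.antidiagonal n, valleyProb (q.1 + 1) (q.2 + 1) =
      (2 ^ (n + 2) - 2) / ((n + 3).factorial : ℝ) := by
  have h1 : ∀ q ∈ Finset.HasAntidiagonal.antidiagonal n, valleyProb (q.1 + 1) (q.2 + 1) =
      ((n + 2).choose (q.1 + 1) : ℝ) / ((n + 3).factorial : ℝ) := by
    rintro ⟨i, j⟩ hq
    rw [Finset.HasAntidiagonal.mem_antidiagonal] at hq
    simp only at hq ⊢
    subst hq
    have hc := Nat.choose_mul_factorial_mul_factorial (n := i + 1 + (j + 1)) (k := i + 1) (by omega)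
    rw [Nat.add_sub_cancel_left] at hc
    have e : i + 1 + (j + 1) = i + j + 2 := by ring
    rw [e] at hc
    have hc' : ((i + j + 2).choose (i + 1) : ℝ) * (i + 1).factorial * (j + 1).factorial =
      (i + j + 2).factorial := by exact_mod_cast hc
    unfold valleyProb
    rw [Nat.factorial_succ (i + j + 2), Nat.cast_mul, ← hc']
    have f1 : (((i + 1).factorial : ℕ) : ℝ) ≠ 0 := by positivity
    have f2 : (((j + 1).factorial : ℕ) : ℝ) ≠ 0 := by positivity
    have f3 : (((i + j + 2).choose (i + 1) : ℕ) : ℝ) ≠ 0 := by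
      exact_mod_cast (Nat.choose_pos (by omega)).ne'
    push_cast
    have f4 : (i : ℝ) + j + 3 ≠ 0 := by positivity
    have e1 : (i : ℝ) + 1 + (j + 1) + 1 = i + j + 3 := by ring
    have e2 : (i : ℝ) + j + 2 + 1 = i + j + 3 := by ring
    rw [e1, e2]
    field_simp
  rw [Finset.sum_congr rfl h1, ← Finset.sum_div,
    Finset.Nat.sum_antidiagonal_eq_sum_range_succ_mk]
  congr 1
  have h2 := Nat.sum_range_choose (n + 2)
  rw [Finset.sum_range_succ, Finset.sum_range_succ'] at h2
  simp only [Nat.choose_self, Nat.choose_zero_right] at h2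
  have h3 : (∑ k ∈ Finset.range (n + 1), ((n + 2).choose (k + 1) : ℝ)) + 1 + 1 = 2 ^ (n + 2) := by
    exact_mod_cast h2
  simp only [Nat.succ_eq_add_one]
  linarith

theorem hasSum_joint_tail :
    HasSum (fun q : ℕ × ℕ => 1 * (3 * valleyProb (q.1 + 1) (q.2 + 1)))
      (3 / 2 * Real.exp 1 ^ 2 - 6 * Real.exp 1 + 15 / 2) := by
  have h2 : HasSum (fun n : ℕ => (2 : ℝ) ^ (n + 3) / ((n + 3).factorial : ℝ))
      (Real.exp 2 - ∑ i ∈ Finset.range 3, (2 : ℝ) ^ i / (i.factorial : ℝ)) := by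
    have := NormedSpace.expSeries_div_hasSum_exp (2 : ℝ)
    rw [← Real.exp_eq_exp_ℝ] at this
    exact (hasSum_nat_add_iff' 3).2 this
  have h3 : HasSum (fun n : ℕ => 3 * ((2 ^ (n + 2) - 2) / ((n + 3).factorial : ℝ)))
      (3 / 2 * Real.exp 1 ^ 2 - 6 * Real.exp 1 + 15 / 2) := by
    convert! ((h2.div_const 2).sub ((hasSum_one_div_factorial_add 3).mul_left 2)).mul_left 3 using 1
    · ext n
      ring
    · have : Real.exp 2 = Real.exp 1 ^ 2 := by rw [← Real.exp_nat_mul]; norm_num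
      rw [this]
      norm_num [Finset.sum_range_succ, Nat.factorial]
      ring
  simp only [one_mul]
  -- The double series is regrouped by diagonals, which is legitimate because its terms are
  -- nonnegative.
  rw [← Finset.HasAntidiagonal.sigmaAntidiagonalEquivProd.hasSum_iff]
  set F : (Σ n : ℕ, Finset.HasAntidiagonal.antidiagonal n) → ℝ :=
    (fun q : ℕ × ℕ => 3 * valleyProb (q.1 + 1) (q.2 + 1)) ∘
      Finset.HasAntidiagonal.sigmaAntidiagonalEquivProd with hF
  have hfib : ∀ n, HasSum (fun q : Finset.HasAntidiagonal.antidiagonal n => F ⟨n, q⟩)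
      (3 * ((2 ^ (n + 2) - 2) / ((n + 3).factorial : ℝ))) := by
    intro n
    rw [← sum_antidiagonal_valleyProb, Finset.mul_sum, ← Finset.sum_coe_sort]
    exact hasSum_fintype _
  have hsummable : Summable F := by
    have hnn : ∀ q, 0 ≤ F q := fun q => mul_nonneg zero_le_three (valleyProb_nonneg _ _)
    rw [summable_sigma_of_nonneg hnn]
    refine ⟨fun n => (hfib n).summable, ?_⟩
    simp only [fun n => (hfib n).tsum_eq]
    exact h3.summable
  have := hsummable.hasSum.sigma hfib
  rw [← this.unique h3]
  exact hsummable.hasSum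

/-! ### Moments from the joint law -/

/-- The joint law of two consecutive distances between extremum points. -/
def HasPeakLaw {Ω : Type*} [MeasurableSpace Ω] (Q : Measure Ω) (Y Z : Ω → ℕ) : Prop :=
  ∀ k l : ℕ, 0 < k → 0 < l → Q.real {ω | Y ω = k ∧ Z ω = l} =
    3 * (valleyProb k l - valleyProb (k + 1) l -
      (valleyProb k (l + 1) - valleyProb (k + 1) (l + 1)))

variable {Y Z : Ω → ℕ}

theorem HasPeakLaw.symm (h : HasPeakLaw Q Y Z) : HasPeakLaw Q Z Y := by
  intro k l hk hl
  have := h l k hl hk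
  simp only [valleyProb_comm l, valleyProb_comm (l + 1)] at this
  simp only [and_comm]
  rw [this]
  ring

/-- Summing over the second distance telescopes one of the two differences; `prob_lt_and_lt` then
telescopes the other. -/
theorem HasPeakLaw.prob_eq_and_lt (h : HasPeakLaw Q Y Z) (hY : Measurable Y) (hZ : Measurable Z)
    {k : ℕ} (hk : 0 < k) (j : ℕ) : Q.real {ω | Y ω = k ∧ j < Z ω} =
      3 * (valleyProb k (j + 1) - valleyProb (k + 1) (j + 1)) := by
  refine measureReal_tail_of_telescoping (A := {ω | Y ω = k}) (hY (measurableSet_singleton k)) hZ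
    (g := fun l => 3 * (valleyProb k l - valleyProb (k + 1) l)) ?_ j fun l hl => ?_
  · simpa using ((tendsto_valleyProb_right k).sub (tendsto_valleyProb_right (k + 1))).const_mul 3
  · refine (h k l hk (by omega)).trans ?_
    ring

theorem HasPeakLaw.prob_lt_and_lt (h : HasPeakLaw Q Y Z) (hY : Measurable Y) (hZ : Measurable Z)
    (i j : ℕ) : Q.real {ω | i < Y ω ∧ j < Z ω} = 3 * valleyProb (i + 1) (j + 1) := by
  have : {ω | i < Y ω ∧ j < Z ω} = {ω | j < Z ω} ∩ {ω | i < Y ω} := by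
    ext; simp [and_comm]
  rw [this]
  refine measureReal_tail_of_telescoping (A := {ω | j < Z ω}) (hZ measurableSet_Ioi) hY
    (g := fun k => 3 * valleyProb k (j + 1)) ?_ i fun k hk => ?_
  · simpa using (tendsto_valleyProb_left (j + 1)).const_mul 3
  · rw [Set.inter_comm]
    refine (h.prob_eq_and_lt hY hZ (by omega) j).trans ?_
    ring

theorem HasPeakLaw.prob_eq (h : HasPeakLaw Q Y Z) (hY : Measurable Y) (hZ : Measurable Z)
    (hpos : ∀ᵐ ω ∂Q, 0 < Z ω) {k : ℕ} (hk : 0 < k) :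
    Q.real {ω | Y ω = k} = 3 * ((k : ℝ) ^ 2 + 3 * k + 1) / ((k + 3).factorial : ℝ) := by
  have h1 := h.prob_eq_and_lt hY hZ hk 0
  have h2 : Q.real {ω | Y ω = k} = Q.real {ω | Y ω = k ∧ 0 < Z ω} := by
    refine measureReal_congr ?_
    filter_upwards [hpos] with ω hω
    exact propext ⟨fun h => ⟨h, hω⟩, fun h => h.1⟩
  rw [h2, h1, valleyProb_one_right, valleyProb_one_right, Nat.factorial_succ (k + 2),
    Nat.factorial_succ (k + 1)]
  have : (((k + 1).factorial : ℕ) : ℝ) ≠ 0 := by positivity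
  push_cast
  field_simp
  ring

theorem HasPeakLaw.prob_lt (h : HasPeakLaw Q Y Z) (hY : Measurable Y) (hZ : Measurable Z)
    (hpos : ∀ᵐ ω ∂Q, 0 < Z ω) (i : ℕ) :
    Q.real {ω | i < Y ω} = 3 * valleyProb (i + 1) 1 := by
  rw [← h.prob_lt_and_lt hY hZ i 0]
  refine measureReal_congr ?_
  filter_upwards [hpos] with ω hω
  exact propext ⟨fun h => ⟨h, hω⟩, fun h => h.1⟩

theorem measurable_natCast_comp (hY : Measurable Y) : Measurable fun ω => (Y ω : ℝ) :=
  (measurable_of_countable (fun n : ℕ => (n : ℝ))).comp hY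

theorem HasPeakLaw.integral_eq (h : HasPeakLaw Q Y Z) (hY : Measurable Y) (hZ : Measurable Z)
    (hpos : ∀ᵐ ω ∂Q, 0 < Z ω) : ∫ ω, (Y ω : ℝ) ∂Q = 3 / 2 := by
  refine (integrable_and_integral_eq_of_hasSum_indicator (A := fun i => {ω | i < Y ω})
    (c := fun _ => 1) (fun i => hY measurableSet_Ioi) (fun _ => zero_le_one)
    (measurable_natCast_comp hY) (fun ω => ?_) ?_).2
  · exact hasSum_indicator_of_finset (Finset.range (Y ω)) (fun i => by simp) (by simp)
  · simp only [h.prob_lt hY hZ hpos]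
    exact hasSum_tail

theorem HasPeakLaw.integral_sq (h : HasPeakLaw Q Y Z) (hY : Measurable Y) (hZ : Measurable Z)
    (hpos : ∀ᵐ ω ∂Q, 0 < Z ω) : Integrable (fun ω => (Y ω : ℝ) ^ 2) Q ∧
      ∫ ω, (Y ω : ℝ) ^ 2 ∂Q = 6 * Real.exp 1 - 27 / 2 := by
  refine integrable_and_integral_eq_of_hasSum_indicator (A := fun i => {ω | i < Y ω})
    (c := fun i => 2 * i + 1) (fun i => hY measurableSet_Ioi) (fun _ => by positivity)
    ((measurable_natCast_comp hY).pow_const 2) (fun ω => ?_) ?_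
  -- The first n odd numbers add up to n².
  · refine hasSum_indicator_of_finset (Finset.range (Y ω)) (fun i => by simp) ?_
    induction Y ω with
    | zero => simp
    | succ n ih => rw [Finset.sum_range_succ, ih]; push_cast; ring
  · simp only [h.prob_lt hY hZ hpos]
    exact hasSum_sq_tail

theorem HasPeakLaw.integral_mul (h : HasPeakLaw Q Y Z) (hY : Measurable Y) (hZ : Measurable Z) :
    ∫ ω, (Y ω : ℝ) * Z ω ∂Q = 3 / 2 * Real.exp 1 ^ 2 - 6 * Real.exp 1 + 15 / 2 := by
  refine (integrable_and_integral_eq_of_hasSum_indicator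
    (A := fun q : ℕ × ℕ => {ω | q.1 < Y ω ∧ q.2 < Z ω})
    (c := fun _ => 1) (fun i => (hY measurableSet_Ioi).inter (hZ measurableSet_Ioi))
    (fun _ => zero_le_one)
    ((measurable_natCast_comp hY).mul (measurable_natCast_comp hZ)) (fun ω => ?_) ?_).2
  · exact hasSum_indicator_of_finset (Finset.range (Y ω) ×ˢ Finset.range (Z ω))
      (fun i => by simp) (by simp)
  · simp only [h.prob_lt_and_lt hY hZ]
    exact hasSum_joint_tail

theorem HasPeakLaw.memLp (h : HasPeakLaw Q Y Z) (hY : Measurable Y) (hZ : Measurable Z)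
    (hpos : ∀ᵐ ω ∂Q, 0 < Z ω) : MemLp (fun ω => (Y ω : ℝ)) 2 Q :=
  (memLp_two_iff_integrable_sq (measurable_natCast_comp hY).aestronglyMeasurable).2
    (h.integral_sq hY hZ hpos).1

theorem HasPeakLaw.variance_eq (h : HasPeakLaw Q Y Z) (hY : Measurable Y) (hZ : Measurable Z)
    (hpos : ∀ᵐ ω ∂Q, 0 < Z ω) :
    variance (fun ω => (Y ω : ℝ)) Q = 6 * Real.exp 1 - 63 / 4 := by
  rw [variance_eq_sub (h.memLp hY hZ hpos), h.integral_eq hY hZ hpos]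
  simp only [Pi.pow_apply]
  rw [(h.integral_sq hY hZ hpos).2]
  ring

theorem HasPeakLaw.corr_eq (h : HasPeakLaw Q Y Z) (hY : Measurable Y) (hZ : Measurable Z)
    (hposY : ∀ᵐ ω ∂Q, 0 < Y ω) (hposZ : ∀ᵐ ω ∂Q, 0 < Z ω) :
    corr (fun ω => (Y ω : ℝ)) (fun ω => (Z ω : ℝ)) Q =
      (2 * Real.exp 1 ^ 2 - 8 * Real.exp 1 + 7) / (8 * Real.exp 1 - 21) := by
  -- The variance is positive because e > 21/8. By the symmetry of the law both variances coincide,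
  -- so the product of the square roots is the variance itself.
  have he := Real.exp_one_gt_d9
  have hv : (0 : ℝ) < 6 * Real.exp 1 - 63 / 4 := by linarith
  unfold corr
  rw [h.variance_eq hY hZ hposZ, h.symm.variance_eq hZ hY hposY, Real.mul_self_sqrt hv.le,
    covariance_eq_sub (h.memLp hY hZ hposZ) (h.symm.memLp hZ hY hposY),
    h.integral_eq hY hZ hposZ, h.symm.integral_eq hZ hY hposY]
  simp only [Pi.mul_apply]
  rw [h.integral_mul hY hZ, div_eq_div_iff hv.ne' (by linarith : 8 * Real.exp 1 - 21 ≠ 0)]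
  ring

end moments
end MonotoneRuns

/-! ### The theorem -/

open MonotoneRuns in
theorem mainTheorem5 {Ω : Type*} [MeasurableSpace Ω] (P : Measure Ω) [IsProbabilityMeasure P]
    (X : ℤ → Ω → ℝ) (hmeas : ∀ t, Measurable (X t)) (hindep : iIndepFun X P)
    (hident : ∀ t, IdentDistrib (X t) (X 0) P P) (hcont : Continuous (cdf (P.map (X 0))))
    -- the probability conditioned on `0` being a maximum point
    (P₀ : Measure Ω) (hP₀ : P₀ = cond P {ω | IsMaxPoint (fun t => X t ω) 0})
    -- the successive distances between the alternating extremum points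
    (μ : ℕ → Ω → ℕ) (hμ : μ = fun t ω => mu (fun s => X s ω) t) :
    (∀ᵐ ω ∂P₀, ∀ t, 0 < μ t ω) ∧
    (∀ (n : ℕ) (k : Fin (n + 1) → ℕ), (∀ i, 0 < k i) →
      P₀.real {ω | ∀ i : Fin (n + 1), μ i ω = k i} = 3 * Omega' (1 :: (List.ofFn k ++ [1]))) ∧
    (∀ k : ℕ, 0 < k →
      P₀.real {ω | μ 0 ω = k} =
        3 * ((k : ℝ) ^ 2 + 3 * k + 1) / (Nat.factorial (k + 3) : ℝ)) ∧
    MemLp (fun ω => (μ 0 ω : ℝ)) 2 P₀ ∧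
    MemLp (fun ω => (μ 1 ω : ℝ)) 2 P₀ ∧
    ∫ ω, (μ 0 ω : ℝ) ∂P₀ = 3 / 2 ∧
    variance (fun ω => (μ 0 ω : ℝ)) P₀ = 6 * Real.exp 1 - 63 / 4 ∧
    corr (fun ω => (μ 0 ω : ℝ)) (fun ω => (μ 1 ω : ℝ)) P₀ =
      (2 * Real.exp 1 ^ 2 - 8 * Real.exp 1 + 7) / (8 * Real.exp 1 - 21) := by
  have : IsProbabilityMeasure (P.map (X 0)) :=
    Measure.isProbabilityMeasure_map (hmeas 0).aemeasurable
  have h : IsAtomlessIID P X := ⟨hmeas, hindep, fun t => (hident t).map_eq,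
    measure_singleton_eq_zero_of_continuous_cdf _ hcont⟩
  have hM : MeasurableSet {ω | IsMaxPoint (fun t => X t ω) 0} := by
    simp only [isMaxPoint_iff]
    exact (h.measurableSet_step 0 (0 - 1)).inter (h.measurableSet_step 1 0)
  have hPM := h.prob_isMaxPoint
  have hM0 : P {ω | IsMaxPoint (fun t => X t ω) 0} ≠ 0 := by
    intro h0
    rw [measureReal_def, h0] at hPM
    norm_num at hPM
  have hprob : IsProbabilityMeasure P₀ := hP₀ ▸ cond_isProbabilityMeasure hM0
  -- Almost sure statements under `P` pass to the conditional probability.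
  have hac : P₀ ≪ P := hP₀ ▸ cond_absolutelyContinuous
  have hpos : ∀ᵐ ω ∂P₀, ∀ t, 0 < μ t ω := by
    refine hac.ae_le ?_
    filter_upwards [h.ae_succ_ne, h.ae_exists_step] with ω h1 h2 t
    rw [hμ]
    exact nextDist_pos h1 h2 _ _
  have hlaw : ∀ (n : ℕ) (k : Fin n → ℕ), (∀ i, 0 < k i) →
      P₀.real {ω | ∀ i : Fin n, μ i ω = k i} =
        3 * P.real {ω | Run (fun t => X t ω) 0 (1 :: (List.ofFn k ++ [1])) (-1)} := by
    intro n k hk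
    have h1 : P.real {ω | Run (fun t => X t ω) 0 (1 :: (List.ofFn k ++ [1])) (-1)} =
        P.real ({ω | IsMaxPoint (fun t => X t ω) 0} ∩ {ω | ∀ i : Fin n, μ i ω = k i}) := by
      refine measureReal_congr ?_
      filter_upwards [h.ae_succ_ne] with ω hω
      rw [hμ]
      exact propext (isMaxPoint_and_mu_eq_iff (x := fun t => X t ω) hω n k hk).symm
    rw [h1, hP₀, measureReal_def, cond_apply hM, ENNReal.toReal_mul, ENNReal.toReal_inv,
      ← measureReal_def, ← measureReal_def, hPM]
    norm_num
  have hmu : ∀ t, Measurable (μ t) := fun t => by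
    rw [hμ]
    exact (measurable_mu t).comp h.measurable_path
  have hpeak : HasPeakLaw P₀ (μ 0) (μ 1) := by
    intro k l hk hl
    rw [← h.prob_peak_valley_peak k l (-1)]
    have := hlaw 2 ![k, l] (by simp [Fin.forall_fin_two, hk, hl])
    simpa [Fin.forall_fin_two] using this
  have hpos0 : ∀ᵐ ω ∂P₀, 0 < μ 0 ω := hpos.mono fun ω hω => hω 0
  have hpos1 : ∀ᵐ ω ∂P₀, 0 < μ 1 ω := hpos.mono fun ω hω => hω 1
  refine ⟨hpos, fun n k hk => ?_, fun k hk => hpeak.prob_eq (hmu 0) (hmu 1) hpos1 hk,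
    hpeak.memLp (hmu 0) (hmu 1) hpos1, hpeak.symm.memLp (hmu 1) (hmu 0) hpos0,
    hpeak.integral_eq (hmu 0) (hmu 1) hpos1, hpeak.variance_eq (hmu 0) (hmu 1) hpos1,
    hpeak.corr_eq (hmu 0) (hmu 1) hpos0 hpos1⟩
  rw [hlaw _ k hk, h.prob_run]
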